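/- Let $\mathcal P$ be the set of parameters $p=(\lambda,a_1,a_2,c_1,c_2)$ with $\lambda\in\mathbb C^*$, $a_1,a_2\in\mathbb C$ such that $a_1+a_2\notin\mathbb Q_{\le 0}$, and $c_1,c_2\in v\,\mathbb C[[v]]$ (formal power series in one variable with null constant term). The normal form with parameters $p$ is the formal vector field at the origin of $\mathbb C^3$, with coordinates $(x,y_1,y_2)$, $$Z_p = x^2\frac{\partial}{\partial x}+\bigl(-\lambda+a_1x+c_1(y_1y_2)\bigr)y_1\frac{\partial}{\partial y_1}+\bigl(\lambda+a_2x+c_2(y_1y_2)\bigr)y_2\frac{\partial}{\partial y_2}.$$ A fibered formal diffeomorphism is a triple $\Phi=(x,\phi_1,\phi_2)$ of formal power series in $\mathbb C[[x,y_1,y_2]]$ without constant term whose Jacobian matrix at the origin is invertible. Two formal vector fields $Y,Y'$ are conjugate by $\Phi$ if $\Phi_*(Y):=(\mathrm D\Phi\cdot Y)\circ\Phi^{-1}=Y'$; equivalently, $\mathcal L_{Y}(f\circ\Phi)=(\mathcal L_{Y'}f)\circ\Phi$ for all $f\in\mathbb C[[x,y_1,y_2]]$, where $\mathcal L$ denotes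 the Lie derivative. Let the group $\mathbb C^*\times\mathbb Z/2\mathbb Z$ act on $\mathcal P$ as follows: $\theta\in\mathbb C^*$ sends $(\lambda,a_1,a_2,c_1(v),c_2(v))$ to $(\lambda,a_1,a_2,c_1(\theta v),c_2(\theta v))$, and the non-trivial element of $\mathbb Z/2\mathbb Z$ sends $(\lambda,a_1,a_2,c_1,c_2)$ to $(-\lambda,a_2,a_1,c_2,c_1)$. Theorem. For all $p,p'\in\mathcal P$, the normal forms $Z_p$ and $Z_{p'}$ are conjugate by a fibered formal diffeomorphism if and only if $p$ and $p'$ lie in the same orbit of the action of $\mathbb C^*\times\mathbb Z/2\mathbb Z$ on $\mathcal P$. -/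

import Mathlib

noncomputable section

namespace SaddleNode

/-- The algebra `ℂ⟦x, y₁, y₂⟧`; the variables `x, y₁, y₂` have the indices `0, 1, 2`. -/
abbrev Series : Type := MvPowerSeries (Fin 3) ℂ

/-- The formal vector field `Y 0 ∂/∂x + Y 1 ∂/∂y₁ + Y 2 ∂/∂y₂`, as the triple of its components. -/
abbrev VectorField : Type := Fin 3 → Series

/-- The Lie derivative `L_Y f = ∑ j, Y j * ∂f/∂xⱼ`. -/
def lieDeriv (Y : VectorField) (f : Series) : Series :=
  ∑ j, Y j * MvPowerSeries.pderiv ℂ j f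

/-- The linear part at the origin of a triple of series, `(∂φᵢ/∂xⱼ (0))ᵢⱼ`. -/
def jacobianAtZero (φ : Fin 3 → Series) : Matrix (Fin 3) (Fin 3) ℂ :=
  Matrix.of fun i j => MvPowerSeries.constantCoeff (MvPowerSeries.pderiv ℂ j (φ i))

/-- A formal diffeomorphism of `ℂ³` fixing the origin. -/
structure FormalDiffeo where
  /-- the components `φ₀, φ₁, φ₂` -/
  comp : Fin 3 → Series
  comp_zero : ∀ i, MvPowerSeries.constantCoeff (comp i) = 0
  isUnit_jacobian : IsUnit (jacobianAtZero comp)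

/-- The pull-back `Φ^* f = f ∘ Φ = f(φ₀, φ₁, φ₂)`. -/
def FormalDiffeo.pullback (Φ : FormalDiffeo) (f : Series) : Series :=
  MvPowerSeries.subst Φ.comp f

/-- `Φ` is fibered in the `x`-coordinate: `(x, y) ↦ (x, φ(x, y))`. -/
def FormalDiffeo.IsFibered (Φ : FormalDiffeo) : Prop :=
  Φ.comp 0 = MvPowerSeries.X 0

/-- `Φ_* Y = Y'`, in the form `L_Y ∘ Φ^* = Φ^* ∘ L_{Y'}` (on the coordinate functions this reads
`DΦ · Y = Y' ∘ Φ`). -/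
def FormalDiffeo.Conjugates (Φ : FormalDiffeo) (Y Y' : VectorField) : Prop :=
  ∀ f : Series, lieDeriv Y (Φ.pullback f) = Φ.pullback (lieDeriv Y' f)

/-- Conjugacy by a fibered formal diffeomorphism. -/
def FiberedConjugate (Y Y' : VectorField) : Prop :=
  ∃ Φ : FormalDiffeo, Φ.IsFibered ∧ Φ.Conjugates Y Y'

/-- The parameter space: `(λ, a₁, a₂, c₁, c₂)` with `λ ≠ 0`, `a₁ + a₂` not a rational number `≤ 0`,
and `c₁, c₂` formal power series in one variable without constant term. -/
@[ext]
structure Param where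
  lam : ℂ
  a₁ : ℂ
  a₂ : ℂ
  c₁ : PowerSeries ℂ
  c₂ : PowerSeries ℂ
  lam_ne_zero : lam ≠ 0
  nondegenerate : ∀ q : ℚ, q ≤ 0 → a₁ + a₂ ≠ (q : ℂ)
  c₁_zero : PowerSeries.constantCoeff c₁ = 0
  c₂_zero : PowerSeries.constantCoeff c₂ = 0

/-- `(λ, a₁, a₂, c₁, c₂) ↦ (λ, a₁, a₂, c₁(θ v), c₂(θ v))`. -/
def Param.scale (θ : ℂˣ) (p : Param) : Param where
  lam := p.lam
  a₁ := p.a₁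
  a₂ := p.a₂
  c₁ := PowerSeries.rescale (θ : ℂ) p.c₁
  c₂ := PowerSeries.rescale (θ : ℂ) p.c₂
  lam_ne_zero := p.lam_ne_zero
  nondegenerate := p.nondegenerate
  c₁_zero := by
    rw [← PowerSeries.coeff_zero_eq_constantCoeff_apply, PowerSeries.coeff_rescale,
      PowerSeries.coeff_zero_eq_constantCoeff_apply, p.c₁_zero, mul_zero]
  c₂_zero := by
    rw [← PowerSeries.coeff_zero_eq_constantCoeff_apply, PowerSeries.coeff_rescale,
      PowerSeries.coeff_zero_eq_constantCoeff_apply, p.c₂_zero, mul_zero]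

/-- `(λ, a₁, a₂, c₁, c₂) ↦ (-λ, a₂, a₁, c₂, c₁)`. -/
def Param.swap (p : Param) : Param where
  lam := -p.lam
  a₁ := p.a₂
  a₂ := p.a₁
  c₁ := p.c₂
  c₂ := p.c₁
  lam_ne_zero := neg_ne_zero.mpr p.lam_ne_zero
  nondegenerate := fun q hq => by rw [add_comm]; exact p.nondegenerate q hq
  c₁_zero := p.c₂_zero
  c₂_zero := p.c₁_zero

theorem Param.swap_swap (p : Param) : p.swap.swap = p := by
  ext1 <;> simp [Param.swap]

theorem Param.scale_swap (θ : ℂˣ) (p : Param) : p.swap.scale θ = (p.scale θ).swap := rfl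

theorem Param.scale_one (p : Param) : p.scale 1 = p := by
  ext1 <;> simp [Param.scale]

theorem Param.scale_mul (θ η : ℂˣ) (p : Param) : p.scale (θ * η) = (p.scale η).scale θ := by
  ext1 <;> simp [Param.scale, PowerSeries.rescale_rescale, mul_comm]

/-- The action of `ℂ^* × ℤ/2ℤ` on the parameter space. -/
instance : MulAction (ℂˣ × Multiplicative (ZMod 2)) Param where
  smul g p := Param.scale g.1 (if g.2.toAdd = 0 then p else p.swap)
  one_smul p := by
    change Param.scale 1 (if (0 : ZMod 2) = 0 then p else p.swap) = p
    rw [if_pos rfl, Param.scale_one]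
  mul_smul g h p := by
    obtain ⟨θ, ε⟩ := g
    obtain ⟨η, δ⟩ := h
    change Param.scale (θ * η) (if ε.toAdd + δ.toAdd = 0 then p else p.swap) =
      Param.scale θ (if ε.toAdd = 0 then Param.scale η (if δ.toAdd = 0 then p else p.swap)
        else (Param.scale η (if δ.toAdd = 0 then p else p.swap)).swap)
    generalize ε.toAdd = e
    generalize δ.toAdd = d
    have h2 : (1 : ZMod 2) + 1 = 0 := by decide
    have h01 : ∀ z : ZMod 2, z = 0 ∨ z = 1 := by decide
    rcases h01 e with rfl | rfl <;> rcases h01 d with rfl | rfl <;>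
      simp [Param.scale_mul, Param.scale_swap, Param.swap_swap, h2]

/-- The normal form
`x² ∂/∂x + (-λ + a₁ x + c₁(v)) y₁ ∂/∂y₁ + (λ + a₂ x + c₂(v)) y₂ ∂/∂y₂`, where `v = y₁ y₂`. -/
def normalForm (p : Param) : VectorField :=
  let x : Series := MvPowerSeries.X 0
  let y₁ : Series := MvPowerSeries.X 1
  let y₂ : Series := MvPowerSeries.X 2
  ![x ^ 2,
    (MvPowerSeries.C (-p.lam) + MvPowerSeries.C p.a₁ * x + p.c₁.subst (y₁ * y₂)) * y₁,
    (MvPowerSeries.C p.lam + MvPowerSeries.C p.a₂ * x + p.c₂.subst (y₁ * y₂)) * y₂]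

end SaddleNode

end

/-! The maps (x, θ y₁, y₂) and (x, θ y₂, y₁) realise the group action. Conversely, a fibered
conjugacy to `normalForm p'` amounts to the equations `IsSolution` for (φ₁, φ₂), which are so rigid
that φ₁ = β y₁ and φ₂ = γ y₂, up to exchanging the two; then θ = βγ.

The rigidity is proved by induction on the degree n in (y₁, y₂). Degree 0 vanishes
(`mem_yIdeal_one`). In degree n ≥ 1, for i + j = n, the coefficients g k of x^k y₁^i y₂^j in φ
satisfy A g 0 + r = 0 and A g (k+1) + (k + B) g k = 0, where A = λ(j - i) - μ with μ the eigenvalue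
in the equation of φ, and r comes from the series c (`affinePart_mem`, `recurrence_of_mem`). If A ≠
0, then r = 0 and all g k vanish. If A = 0, the exponent is resonant. For n = 1 the invertible
Jacobian forces B = 0, which identifies a₁ and a₂. For n ≥ 2 one has B = m(a₁ + a₂) with m ≥ 1, so k
+ B ≠ 0 by nondegeneracy and g k = 0, while r = 0 compares the m-th coefficients of the series c. -/

namespace MvPowerSeries
-- Chain rule for formal substitution
open WithPiTopology in
theorem continuous_pderiv {σ R : Type*} [CommRing R] [TopologicalSpace R] [IsTopologicalRing R]
    (i : σ) : Continuous (pderiv R i : MvPowerSeries σ R → MvPowerSeries σ R) := by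
  refine continuous_pi fun d => ?_
  change Continuous fun f : MvPowerSeries σ R => coeff d (pderiv R i f)
  simp only [coeff_pderiv]
  exact (continuous_coeff R _).mul continuous_const

open WithPiTopology in
/-- The chain rule for substitution into a power series. -/
theorem pderiv_subst {σ τ R : Type*} [Fintype σ] [CommRing R]
    {a : σ → MvPowerSeries τ R} (ha : HasSubst a) (i : τ) (f : MvPowerSeries σ R) :
    pderiv R i (subst a f) = ∑ j, subst a (pderiv R j f) * pderiv R i (a j) := by
  classical
  -- For the discrete topology on R both sides are continuous in f, so density of polynomials
  -- reduces the identity to polynomial f.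
  let _ : UniformSpace R := ⊥
  have : DiscreteUniformity R := ⟨rfl⟩
  have : DiscreteTopology R := inferInstance
  have hs : Continuous (subst a : MvPowerSeries σ R → MvPowerSeries τ R) := continuous_subst ha
  have h₁ : Continuous fun f : MvPowerSeries σ R => pderiv R i (subst a f) :=
    (continuous_pderiv i).comp hs
  have h₂ : Continuous fun f : MvPowerSeries σ R =>
      ∑ j, subst a (pderiv R j f) * pderiv R i (a j) :=
    continuous_finsetSum _ fun j _ => (hs.comp (continuous_pderiv j)).mul continuous_const
  refine congrFun (denseRange_toMvPowerSeries.equalizer h₁ h₂ ?_) f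
  funext q
  have hz : subst a (0 : MvPowerSeries σ R) = 0 := by rw [← coe_substAlgHom ha, map_zero]
  have ho : subst a (1 : MvPowerSeries σ R) = 1 := by rw [← coe_substAlgHom ha, map_one]
  simp only [Function.comp_apply]
  induction q using MvPolynomial.induction_on with
  | C r => simp only [MvPolynomial.coe_C, pderiv_C, subst_C, hz, zero_mul, Finset.sum_const_zero]
  | add p q hp hq =>
    simp only [MvPolynomial.coe_add, map_add, subst_add ha, hp, hq, add_mul,
      Finset.sum_add_distrib]
  | mul_X p s hp =>
    simp only [MvPolynomial.coe_mul, MvPolynomial.coe_X, Derivation.leibniz, smul_eq_mul,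
      subst_mul ha, subst_add ha, subst_X ha, hp, add_mul, Finset.sum_add_distrib,
      Finset.mul_sum]
    congr 1
    · rw [Finset.sum_eq_single s]
      · rw [pderiv_X_self, ho, mul_one]
      · intro j _ hj
        rw [pderiv_X_of_ne hj.symm, hz, mul_zero, zero_mul]
      · simp
    · exact Finset.sum_congr rfl fun _ _ => by ring
end MvPowerSeries

/-! ### Conjugacy as a system of equations -/

noncomputable section
namespace SaddleNode
open MvPowerSeries

theorem FormalDiffeo.hasSubst (Φ : FormalDiffeo) : HasSubst Φ.comp :=
  hasSubst_of_constantCoeff_zero Φ.comp_zero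

theorem FormalDiffeo.pullback_X (Φ : FormalDiffeo) (i : Fin 3) : Φ.pullback (X i) = Φ.comp i :=
  subst_X Φ.hasSubst i

theorem lieDeriv_X (Y : VectorField) (i : Fin 3) : lieDeriv Y (X i) = Y i := by
  classical
  simp [lieDeriv, pderiv_X, Pi.single_apply]

/-- A conjugacy may be tested on the coordinate functions. -/
theorem FormalDiffeo.conjugates_iff (Φ : FormalDiffeo) (Y Y' : VectorField) :
    Φ.Conjugates Y Y' ↔ ∀ i, lieDeriv Y (Φ.comp i) = Φ.pullback (Y' i) := by
  refine ⟨fun h i => ?_, fun h f => ?_⟩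
  · rw [← Φ.pullback_X, h, lieDeriv_X]
  · have h₁ : Φ.pullback (lieDeriv Y' f) =
        ∑ i, Φ.pullback (Y' i) * subst Φ.comp (pderiv ℂ i f) := by
      simp only [lieDeriv, FormalDiffeo.pullback, ← coe_substAlgHom Φ.hasSubst, map_sum, map_mul]
    rw [h₁]
    simp only [← h]
    simp only [lieDeriv, FormalDiffeo.pullback, pderiv_subst Φ.hasSubst, Finset.mul_sum,
      Finset.sum_mul]
    rw [Finset.sum_comm]
    exact Finset.sum_congr rfl fun _ _ => Finset.sum_congr rfl fun _ _ => by ring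

theorem FormalDiffeo.pullback_powerSeries_subst (Φ : FormalDiffeo) (c : PowerSeries ℂ)
    {u : Series} (hu : constantCoeff u = 0) :
    Φ.pullback (c.subst u) = c.subst (Φ.pullback u) :=
  subst_comp_subst_apply (PowerSeries.HasSubst.const
    (PowerSeries.HasSubst.of_constantCoeff_zero hu)) Φ.hasSubst c

/-- The equations satisfied by the components of a fibered conjugacy to a normal form. -/
def IsSolution (Y : VectorField) (p : Param) (φ₁ φ₂ : Series) : Prop :=
  lieDeriv Y φ₁ = (C (-p.lam) + C p.a₁ * X 0 + p.c₁.subst (φ₁ * φ₂)) * φ₁ ∧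
  lieDeriv Y φ₂ = (C p.lam + C p.a₂ * X 0 + p.c₂.subst (φ₁ * φ₂)) * φ₂

theorem FormalDiffeo.conjugates_normalForm_iff (Φ : FormalDiffeo) (hΦ : Φ.IsFibered)
    (Y : VectorField) (hY : Y 0 = X 0 ^ 2) (p : Param) :
    Φ.Conjugates Y (normalForm p) ↔ IsSolution Y p (Φ.comp 1) (Φ.comp 2) := by
  have h0 : lieDeriv Y (Φ.comp 0) = Φ.pullback (normalForm p 0) := by
    rw [hΦ, lieDeriv_X, hY]
    simp only [normalForm, Matrix.cons_val_zero]
    rw [FormalDiffeo.pullback, subst_pow Φ.hasSubst, subst_X Φ.hasSubst, hΦ]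
  have hv : Φ.pullback (X 1 * X 2) = Φ.comp 1 * Φ.comp 2 := by
    rw [FormalDiffeo.pullback, subst_mul Φ.hasSubst, subst_X Φ.hasSubst, subst_X Φ.hasSubst]
  have key (l a : ℂ) (c : PowerSeries ℂ) (i : Fin 3) :
      Φ.pullback ((C l + C a * X 0 + c.subst (X 1 * X 2 : Series)) * X i) =
        (C l + C a * X 0 + c.subst (Φ.comp 1 * Φ.comp 2)) * Φ.comp i := by
    rw [FormalDiffeo.pullback, subst_mul Φ.hasSubst, subst_add Φ.hasSubst, subst_add Φ.hasSubst,
      subst_mul Φ.hasSubst, subst_C, subst_C, subst_X Φ.hasSubst, subst_X Φ.hasSubst, hΦ, ← hv,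
      ← Φ.pullback_powerSeries_subst c (by simp)]
    rfl
  rw [Φ.conjugates_iff, Fin.forall_fin_succ, Fin.forall_fin_two, and_iff_right h0]
  exact and_congr (by rw [← key]; rfl) (by rw [← key]; rfl)

/-! ### Parameters in one orbit give conjugate normal forms -/

theorem lieDeriv_C_mul (Y : VectorField) (a : ℂ) (f : Series) :
    lieDeriv Y (C a * f) = C a * lieDeriv Y f := by
  simp [lieDeriv, Finset.mul_sum, Derivation.leibniz, mul_left_comm]

theorem fiberedConjugate_of_isSolution {p p' : Param} {φ₁ φ₂ : Series}
    (h₁ : constantCoeff φ₁ = 0) (h₂ : constantCoeff φ₂ = 0)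
    (hJ : IsUnit (jacobianAtZero ![X 0, φ₁, φ₂])) (h : IsSolution (normalForm p) p' φ₁ φ₂) :
    FiberedConjugate (normalForm p) (normalForm p') := by
  let Φ : FormalDiffeo := ⟨![X 0, φ₁, φ₂], by simp [Fin.forall_fin_succ, h₁, h₂], hJ⟩
  exact ⟨Φ, rfl, (Φ.conjugates_normalForm_iff rfl _ rfl p').2 h⟩

theorem rescale_subst (θ : ℂ) (c : PowerSeries ℂ) {u : Series} (hu : constantCoeff u = 0) :
    (PowerSeries.rescale θ c).subst u = c.subst (C θ * u) := by
  have hs := PowerSeries.HasSubst.of_constantCoeff_zero (S := ℂ) hu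
  rw [PowerSeries.rescale_eq_subst, PowerSeries.subst_comp_subst_apply
    (PowerSeries.HasSubst.smul_X' θ) hs, PowerSeries.subst_smul hs, PowerSeries.subst_X hs,
    smul_eq_C_mul]

/-- The map (x, θ y₁, y₂) multiplies v = y₁ y₂ by θ and leaves the affine part unchanged. -/
theorem fiberedConjugate_scale (θ : ℂˣ) (p : Param) :
    FiberedConjugate (normalForm (p.scale θ)) (normalForm p) := by
  refine fiberedConjugate_of_isSolution (φ₁ := C (θ : ℂ) * X 1) (φ₂ := X 2)
    (by simp) (by simp) ?_ ⟨?_, ?_⟩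
  · rw [Matrix.isUnit_iff_isUnit_det, Matrix.det_fin_three]
    simp [jacobianAtZero, pderiv_X_self, pderiv_X_of_ne]
  · rw [lieDeriv_C_mul, lieDeriv_X]
    simp only [normalForm, Param.scale, Matrix.cons_val]
    rw [rescale_subst _ _ (by simp)]
    ring_nf
  · rw [lieDeriv_X]
    simp only [normalForm, Param.scale, Matrix.cons_val]
    rw [rescale_subst _ _ (by simp), mul_assoc]

theorem fiberedConjugate_scale_swap (θ : ℂˣ) (p : Param) :
    FiberedConjugate (normalForm (p.swap.scale θ)) (normalForm p) := by
  refine fiberedConjugate_of_isSolution (φ₁ := C (θ : ℂ) * X 2) (φ₂ := X 1)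
    (by simp) (by simp) ?_ ⟨?_, ?_⟩
  · rw [Matrix.isUnit_iff_isUnit_det, Matrix.det_fin_three]
    simp [jacobianAtZero, pderiv_X_self, pderiv_X_of_ne]
  · rw [lieDeriv_C_mul, lieDeriv_X]
    simp only [normalForm, Param.scale, Param.swap, Matrix.cons_val]
    rw [rescale_subst _ _ (by simp)]
    ring_nf
  · rw [lieDeriv_X]
    simp only [normalForm, Param.scale, Param.swap, Matrix.cons_val, neg_neg]
    rw [rescale_subst _ _ (by simp)]
    ring_nf

theorem mem_orbit_iff (p p' : Param) :
    p ∈ MulAction.orbit (ℂˣ × Multiplicative (ZMod 2)) p' ↔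
      ∃ θ : ℂˣ, p = p'.scale θ ∨ p = p'.swap.scale θ := by
  constructor
  · rintro ⟨⟨θ, ε⟩, rfl⟩
    refine ⟨θ, ?_⟩
    change Param.scale θ (if ε.toAdd = 0 then p' else p'.swap) = _ ∨
      Param.scale θ (if ε.toAdd = 0 then p' else p'.swap) = _
    split_ifs <;> simp
  · rintro ⟨θ, rfl | rfl⟩
    · refine ⟨⟨θ, 1⟩, ?_⟩
      change Param.scale θ (if (0 : ZMod 2) = 0 then p' else p'.swap) = _
      rw [if_pos rfl]
    · refine ⟨⟨θ, Multiplicative.ofAdd 1⟩, ?_⟩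
      change Param.scale θ (if (1 : ZMod 2) = 0 then p' else p'.swap) = _
      rw [if_neg (by decide)]

/-! ### Coefficients and Euler derivations -/

/-- The exponent of the monomial `x ^ k * y₁ ^ i * y₂ ^ j`. -/
def expo (k i j : ℕ) : Fin 3 →₀ ℕ :=
  Finsupp.equivFunOnFinite.symm ![k, i, j]

@[simp] theorem expo_apply_zero (k i j : ℕ) : expo k i j 0 = k := rfl

@[simp] theorem expo_apply_one (k i j : ℕ) : expo k i j 1 = i := rfl

@[simp] theorem expo_apply_two (k i j : ℕ) : expo k i j 2 = j := rfl

theorem eq_expo (d : Fin 3 →₀ ℕ) : d = expo (d 0) (d 1) (d 2) := by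
  ext i
  fin_cases i <;> rfl

theorem expo_inj {k i j k' i' j' : ℕ} :
    expo k i j = expo k' i' j' ↔ k = k' ∧ i = i' ∧ j = j' := by
  refine ⟨fun h => ⟨?_, ?_, ?_⟩, fun ⟨h₁, h₂, h₃⟩ => by rw [h₁, h₂, h₃]⟩
  · simpa using DFunLike.congr_fun h 0
  · simpa using DFunLike.congr_fun h 1
  · simpa using DFunLike.congr_fun h 2

theorem expo_add (k i j k' i' j' : ℕ) :
    expo k i j + expo k' i' j' = expo (k + k') (i + i') (j + j') := by
  ext s
  fin_cases s <;> rfl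

theorem X_zero_eq : (X 0 : Series) = monomial (expo 1 0 0) 1 := by
  rw [X_def, eq_expo (Finsupp.single 0 1)]
  simp

theorem X_one_eq : (X 1 : Series) = monomial (expo 0 1 0) 1 := by
  rw [X_def, eq_expo (Finsupp.single 1 1)]
  simp

theorem X_two_eq : (X 2 : Series) = monomial (expo 0 0 1) 1 := by
  rw [X_def, eq_expo (Finsupp.single 2 1)]
  simp

theorem coeff_zero_X_zero_mul (f : Series) (i j : ℕ) : coeff (expo 0 i j) (X 0 * f) = 0 := by
  rw [X_zero_eq, coeff_monomial_mul, if_neg]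
  intro h
  simpa using h 0

theorem coeff_succ_X_zero_mul (f : Series) (k i j : ℕ) :
    coeff (expo (k + 1) i j) (X 0 * f) = coeff (expo k i j) f := by
  have : expo (k + 1) i j = expo 1 0 0 + expo k i j := by
    rw [expo_add, expo_inj]
    omega
  rw [X_zero_eq, this, coeff_add_monomial_mul, one_mul]

/-- The homogeneous derivation `xᵢ ∂/∂xᵢ`. -/
def euler (i : Fin 3) (f : Series) : Series := X i * pderiv ℂ i f

theorem coeff_euler (i : Fin 3) (f : Series) (d : Fin 3 →₀ ℕ) :
    coeff d (euler i f) = d i * coeff d f := by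
  classical
  rw [euler, X_def, coeff_monomial_mul]
  split_ifs with h
  · rw [coeff_pderiv, tsub_add_cancel_of_le h, one_mul, mul_comm]
    congr 1
    have : 1 ≤ d i := by simpa using h i
    rw [Finsupp.tsub_apply, Finsupp.single_eq_same, Nat.cast_sub this]
    simp
  · have : d i = 0 := by
      by_contra h0
      exact h (Finsupp.single_le_iff.2 (Nat.one_le_iff_ne_zero.2 h0))
    simp [this]

theorem euler_add (i : Fin 3) (f g : Series) : euler i (f + g) = euler i f + euler i g := by
  simp [euler, mul_add]

theorem euler_C_mul (i : Fin 3) (a : ℂ) (f : Series) : euler i (C a * f) = C a * euler i f := by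
  simp [euler, Derivation.leibniz, mul_left_comm]

theorem euler_X_self (i : Fin 3) : euler i (X i) = X i := by
  simp [euler, pderiv_X_self]

theorem euler_X_of_ne {i j : Fin 3} (h : j ≠ i) : euler i (X j) = 0 := by
  simp [euler, pderiv_X_of_ne h]

/-! ### Filtration by the degree in (y₁, y₂) -/

/-- The ideal `(y₁, y₂) ^ n`: no monomial of degree less than `n` in `(y₁, y₂)` occurs. -/
def yIdeal (n : ℕ) : Ideal Series where
  carrier := {f | ∀ d : Fin 3 →₀ ℕ, d 1 + d 2 < n → coeff d f = 0}
  zero_mem' := fun _ _ => map_zero _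
  add_mem' := fun hf hg d hd => by rw [map_add, hf d hd, hg d hd, add_zero]
  smul_mem' := fun c f hf d hd => by
    classical
    rw [smul_eq_mul, coeff_mul]
    refine Finset.sum_eq_zero fun x hx => ?_
    rw [← Finset.HasAntidiagonal.mem_antidiagonal.1 hx] at hd
    rw [hf x.2 (by simp only [Finsupp.add_apply] at hd; omega), mul_zero]

theorem mem_yIdeal {n : ℕ} {f : Series} :
    f ∈ yIdeal n ↔ ∀ k i j, i + j < n → coeff (expo k i j) f = 0 := by
  refine ⟨fun h k i j hij => h _ hij, fun h d hd => ?_⟩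
  rw [eq_expo d]
  exact h _ _ _ hd

theorem mem_yIdeal_succ {n : ℕ} {f : Series} :
    f ∈ yIdeal (n + 1) ↔ f ∈ yIdeal n ∧ ∀ k i j, i + j = n → coeff (expo k i j) f = 0 := by
  simp only [mem_yIdeal]
  refine ⟨fun h => ⟨fun k i j hij => h k i j (by omega), fun k i j hij => h k i j (by omega)⟩,
    fun h k i j hij => ?_⟩
  rcases Nat.lt_succ_iff_lt_or_eq.1 hij with h' | h'
  exacts [h.1 k i j h', h.2 k i j h']

theorem yIdeal_anti {m n : ℕ} (h : m ≤ n) {f : Series} (hf : f ∈ yIdeal n) : f ∈ yIdeal m :=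
  fun d hd => hf d (hd.trans_le h)

theorem mul_mem_yIdeal {m n : ℕ} {f g : Series} (hf : f ∈ yIdeal m) (hg : g ∈ yIdeal n) :
    f * g ∈ yIdeal (m + n) := by
  classical
  intro d hd
  rw [coeff_mul]
  refine Finset.sum_eq_zero fun x hx => ?_
  rw [← Finset.HasAntidiagonal.mem_antidiagonal.1 hx] at hd
  simp only [Finsupp.add_apply] at hd
  by_cases h : x.1 1 + x.1 2 < m
  · rw [hf _ h, zero_mul]
  · rw [hg x.2 (by omega), mul_zero]

theorem X_one_mem : (X 1 : Series) ∈ yIdeal 1 := by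
  classical
  refine mem_yIdeal.2 fun k i j hij => ?_
  rw [X_one_eq, coeff_monomial_ne]
  rw [Ne, expo_inj]
  omega

theorem X_two_mem : (X 2 : Series) ∈ yIdeal 1 := by
  classical
  refine mem_yIdeal.2 fun k i j hij => ?_
  rw [X_two_eq, coeff_monomial_ne]
  rw [Ne, expo_inj]
  omega

theorem euler_mem {n : ℕ} (i : Fin 3) {f : Series} (hf : f ∈ yIdeal n) : euler i f ∈ yIdeal n :=
  fun d hd => by rw [coeff_euler, hf d hd, mul_zero]

theorem constantCoeff_eq_zero_of_mem {n : ℕ} {f : Series} (hf : f ∈ yIdeal (n + 1)) :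
    constantCoeff f = 0 := hf 0 (by simp)

/-- Since u - w divides u^m - w^m, the congruence passes to powers, and then to c because membership
is tested on each coefficient. -/
theorem subst_sub_subst_mem {n : ℕ} (c : PowerSeries ℂ) {u w : Series}
    (hu : constantCoeff u = 0) (hw : constantCoeff w = 0) (h : u - w ∈ yIdeal n) :
    c.subst u - c.subst w ∈ yIdeal n := by
  intro d hd
  rw [map_sub, sub_eq_zero,
    PowerSeries.coeff_subst (PowerSeries.HasSubst.of_constantCoeff_zero hu),
    PowerSeries.coeff_subst (PowerSeries.HasSubst.of_constantCoeff_zero hw)]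
  refine finsum_congr fun m => ?_
  have : u ^ m - w ^ m ∈ yIdeal n := Ideal.mem_of_dvd _ (sub_dvd_pow_sub_pow u w m) h
  have := this d hd
  rw [map_sub, sub_eq_zero] at this
  rw [this]

theorem subst_mem {n : ℕ} {c : PowerSeries ℂ} (hc : PowerSeries.constantCoeff c = 0) {u : Series}
    (hu : u ∈ yIdeal (n + 1)) : c.subst u ∈ yIdeal (n + 1) := by
  have h0 : c.subst (0 : Series) = 0 := PowerSeries.subst_zero_of_constantCoeff_zero hc
  simpa only [h0, sub_zero] using subst_sub_subst_mem c (w := 0)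
    (constantCoeff_eq_zero_of_mem hu) (map_zero _) (by simpa using hu)

theorem resonant_mem (θ : ℂ) : C θ * (X 1 * X 2 : Series) ∈ yIdeal 2 :=
  Ideal.mul_mem_left _ _ (mul_mem_yIdeal X_one_mem X_two_mem)

theorem coeff_subst_resonant (θ : ℂ) (c : PowerSeries ℂ) (k i j : ℕ) :
    coeff (expo k i j) (c.subst (C θ * (X 1 * X 2 : Series))) =
      if k = 0 ∧ i = j then PowerSeries.coeff i c * θ ^ i else 0 := by
  classical
  have hpow (m : ℕ) : (C θ * (X 1 * X 2 : Series)) ^ m = monomial (expo 0 m m) (θ ^ m) := by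
    rw [X_one_eq, X_two_eq, monomial_mul_monomial, ← monomial_zero_eq_C_apply,
      monomial_mul_monomial, monomial_pow, expo_add]
    congr 1
    · congr 1
      ext s
      fin_cases s <;> simp [expo]
    · simp
  rw [PowerSeries.coeff_subst (PowerSeries.HasSubst.of_constantCoeff_zero
    (constantCoeff_eq_zero_of_mem (resonant_mem θ)))]
  simp only [hpow, coeff_monomial, expo_inj, smul_eq_mul]
  rw [finsum_eq_single _ i]
  · by_cases h : k = 0 ∧ i = j
    · obtain ⟨rfl, rfl⟩ := h
      simp
    · rw [if_neg h, if_neg (by omega), mul_zero]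
  · intro m hm
    rw [if_neg (by omega), mul_zero]

theorem coeff_subst_resonant_mul_X_one (θ : ℂ) (c : PowerSeries ℂ) (k i j : ℕ) :
    coeff (expo k i j) (c.subst (C θ * (X 1 * X 2 : Series)) * X 1) =
      if k = 0 ∧ i = j + 1 then PowerSeries.coeff j c * θ ^ j else 0 := by
  classical
  rw [X_one_eq]
  cases i with
  | zero =>
    rw [coeff_mul_monomial, if_neg, if_neg (by omega)]
    intro h
    simpa using h 1
  | succ i =>
    have : expo k (i + 1) j = expo k i j + expo 0 1 0 := by rw [expo_add, expo_inj]; omega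
    rw [this, coeff_add_mul_monomial, ← X_one_eq, coeff_subst_resonant, mul_one]
    by_cases h : k = 0 ∧ i = j
    · obtain ⟨rfl, rfl⟩ := h
      simp
    · rw [if_neg h, if_neg (by omega)]

theorem coeff_subst_resonant_mul_X_two (θ : ℂ) (c : PowerSeries ℂ) (k i j : ℕ) :
    coeff (expo k i j) (c.subst (C θ * (X 1 * X 2 : Series)) * X 2) =
      if k = 0 ∧ j = i + 1 then PowerSeries.coeff i c * θ ^ i else 0 := by
  classical
  rw [X_two_eq]
  cases j with
  | zero =>
    rw [coeff_mul_monomial, if_neg, if_neg (by omega)]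
    intro h
    simpa using h 2
  | succ j =>
    have : expo k i (j + 1) = expo k i j + expo 0 0 1 := by rw [expo_add, expo_inj]; omega
    rw [this, coeff_add_mul_monomial, ← X_two_eq, coeff_subst_resonant, mul_one]
    by_cases h : k = 0 ∧ i = j
    · obtain ⟨rfl, rfl⟩ := h
      simp
    · rw [if_neg h, if_neg (by omega)]

/-! ### Recurrences in a fixed degree -/

/-- The part `x² ∂/∂x + (-λ + a₁ x) y₁ ∂/∂y₁ + (λ + a₂ x) y₂ ∂/∂y₂` of the normal form. -/
def affinePart (p : Param) (f : Series) : Series :=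
  X 0 * (euler 0 f + C p.a₁ * euler 1 f + C p.a₂ * euler 2 f) +
    C p.lam * (euler 2 f - euler 1 f)

/-- The affine part preserves the degree in (y₁, y₂), whereas the remaining terms raise it by at
least two. -/
theorem lieDeriv_normalForm (p : Param) (f : Series) :
    lieDeriv (normalForm p) f = affinePart p f +
      (p.c₁.subst (X 1 * X 2 : Series) * euler 1 f +
        p.c₂.subst (X 1 * X 2 : Series) * euler 2 f) := by
  simp only [lieDeriv, Fin.sum_univ_three, normalForm, Matrix.cons_val, affinePart, euler,
    map_neg]
  ring

theorem coeff_zero_affinePart (p : Param) (f : Series) (i j : ℕ) :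
    coeff (expo 0 i j) (affinePart p f) = p.lam * (j - i) * coeff (expo 0 i j) f := by
  simp only [affinePart, map_add, coeff_zero_X_zero_mul, coeff_C_mul, map_sub, coeff_euler,
    expo_apply_one, expo_apply_two]
  ring

theorem coeff_succ_affinePart (p : Param) (f : Series) (k i j : ℕ) :
    coeff (expo (k + 1) i j) (affinePart p f) =
      p.lam * (j - i) * coeff (expo (k + 1) i j) f +
        (k + p.a₁ * i + p.a₂ * j) * coeff (expo k i j) f := by
  simp only [affinePart, map_add, coeff_succ_X_zero_mul, coeff_C_mul, map_sub, coeff_euler,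
    expo_apply_zero, expo_apply_one, expo_apply_two]
  ring

/-- The equation `L_Z φ = (μ + b x + e(u)) φ` modulo `(y₁, y₂) ^ (n + 1)`, when `φ` is known modulo
`(y₁, y₂) ^ n`. -/
theorem affinePart_mem {p : Param} {n : ℕ} {φ u y : Series} {μ b β θ : ℂ} {c e : PowerSeries ℂ}
    (he : PowerSeries.constantCoeff e = 0)
    (hy : p.c₁.subst (X 1 * X 2 : Series) * euler 1 y +
      p.c₂.subst (X 1 * X 2 : Series) * euler 2 y = c.subst (X 1 * X 2 : Series) * y)
    (hφ : φ - C β * y ∈ yIdeal n) (hu : u - C θ * (X 1 * X 2) ∈ yIdeal (n + 1))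
    (h : lieDeriv (normalForm p) φ = (C μ + C b * X 0 + e.subst u) * φ) :
    affinePart p φ - (C μ + C b * X 0) * φ +
      C β * (c.subst (C 1 * (X 1 * X 2) : Series) * y - e.subst (C θ * (X 1 * X 2) : Series) * y)
      ∈ yIdeal (n + 1) := by
  rw [map_one, one_mul]
  have hv : (X 1 * X 2 : Series) ∈ yIdeal 2 := mul_mem_yIdeal X_one_mem X_two_mem
  have hθ := resonant_mem θ
  have hθ0 := constantCoeff_eq_zero_of_mem hθ
  have hu0 : constantCoeff u = 0 := by
    simpa [hθ0] using constantCoeff_eq_zero_of_mem hu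
  obtain ⟨ψ, rfl⟩ : ∃ ψ, φ = ψ + C β * y := ⟨φ - C β * y, by ring⟩
  rw [add_sub_cancel_right] at hφ
  have key {f g : Series} (hf : f ∈ yIdeal 2) (hg : g ∈ yIdeal n) : f * g ∈ yIdeal (n + 1) :=
    yIdeal_anti (by omega) (mul_mem_yIdeal hf hg)
  have m₁ := key (subst_mem p.c₁_zero hv) (euler_mem 1 hφ)
  have m₂ := key (subst_mem p.c₂_zero hv) (euler_mem 2 hφ)
  have m₃ := key (subst_mem he hθ) hφ
  have m₄ := Ideal.mul_mem_right (ψ + C β * y) _ (subst_sub_subst_mem e hu0 hθ0 hu)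
  -- With v = y₁ y₂, this uses e(u) φ - β e(θv) y = (e(u) - e(θv)) φ + e(θv) ψ.
  convert Ideal.add_mem _ (Ideal.sub_mem _ (Ideal.sub_mem _ m₃ m₂) m₁) m₄ using 1
  rw [lieDeriv_normalForm, euler_add, euler_add, euler_C_mul, euler_C_mul] at h
  linear_combination h - C β * hy

theorem recurrence_of_mem {p : Param} {n : ℕ} {φ r : Series} {μ b : ℂ}
    (h : affinePart p φ - (C μ + C b * X 0) * φ + r ∈ yIdeal (n + 1)) {i j : ℕ}
    (hij : i + j = n) :
    (p.lam * (j - i) - μ) * coeff (expo 0 i j) φ + coeff (expo 0 i j) r = 0 ∧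
    ∀ k, (p.lam * (j - i) - μ) * coeff (expo (k + 1) i j) φ +
      (k + (p.a₁ * i + p.a₂ * j - b)) * coeff (expo k i j) φ + coeff (expo (k + 1) i j) r = 0 := by
  rw [mem_yIdeal] at h
  refine ⟨?_, fun k => ?_⟩
  · have := h 0 i j (by omega)
    rw [add_mul, mul_assoc, map_add, map_sub, map_add, coeff_C_mul, coeff_C_mul,
      coeff_zero_affinePart, coeff_zero_X_zero_mul] at this
    linear_combination this
  · have := h (k + 1) i j (by omega)
    rw [add_mul, mul_assoc, map_add, map_sub, map_add, coeff_C_mul, coeff_C_mul,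
      coeff_succ_affinePart, coeff_succ_X_zero_mul] at this
    linear_combination this

theorem eq_zero_of_recurrence {g : ℕ → ℂ} {A B : ℂ} (hA : A ≠ 0) (h0 : A * g 0 = 0)
    (h : ∀ k : ℕ, A * g (k + 1) + (k + B) * g k = 0) (k : ℕ) : g k = 0 := by
  induction k with
  | zero => exact (mul_eq_zero.1 h0).resolve_left hA
  | succ k ih => simpa [ih, hA] using h k

/-- On the axis y = 0, the coefficient of x^k equates μ g k with a combination of the g l for l < k,
because e(u) has no constant term; as μ ≠ 0, strong induction applies. -/
theorem mem_yIdeal_one {p : Param} {φ u : Series} {μ b : ℂ} {e : PowerSeries ℂ} (hμ : μ ≠ 0)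
    (he : PowerSeries.constantCoeff e = 0) (hu : constantCoeff u = 0)
    (h : lieDeriv (normalForm p) φ = (C μ + C b * X 0 + e.subst u) * φ) : φ ∈ yIdeal 1 := by
  classical
  have hc : p.c₁.subst (X 1 * X 2 : Series) * euler 1 φ +
      p.c₂.subst (X 1 * X 2 : Series) * euler 2 φ ∈ yIdeal 1 := by
    have hv : (X 1 * X 2 : Series) ∈ yIdeal 1 := Ideal.mul_mem_left _ _ X_two_mem
    exact Ideal.add_mem _ (Ideal.mul_mem_right _ _ (subst_mem p.c₁_zero hv))
      (Ideal.mul_mem_right _ _ (subst_mem p.c₂_zero hv))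
  have hE : constantCoeff (e.subst u) = 0 := PowerSeries.constantCoeff_subst_eq_zero hu e he
  have hm : affinePart p φ - (C μ + C b * X 0) * φ + -(e.subst u * φ) ∈ yIdeal (0 + 1) := by
    rw [lieDeriv_normalForm] at h
    convert Ideal.neg_mem_iff _ |>.2 hc using 1
    linear_combination h
  obtain ⟨r0, rs⟩ := recurrence_of_mem hm (i := 0) (j := 0) rfl
  suffices ∀ k, coeff (expo k 0 0) φ = 0 by
    refine mem_yIdeal.2 fun k i j hij => ?_
    obtain ⟨rfl, rfl⟩ : i = 0 ∧ j = 0 := by omega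
    exact this k
  intro k
  induction k using Nat.strong_induction_on with
  | _ k ih =>
    have hr : coeff (expo k 0 0) (e.subst u * φ) = 0 := by
      rw [coeff_mul]
      refine Finset.sum_eq_zero fun x hx => ?_
      have hx' := Finset.HasAntidiagonal.mem_antidiagonal.1 hx
      have e0 : x.1 0 + x.2 0 = k := DFunLike.congr_fun hx' 0
      have e1 : x.1 1 + x.2 1 = 0 := DFunLike.congr_fun hx' 1
      have e2 : x.1 2 + x.2 2 = 0 := DFunLike.congr_fun hx' 2
      by_cases hk : x.2 0 < k
      · rw [eq_expo x.2, show x.2 1 = 0 by omega, show x.2 2 = 0 by omega, ih _ hk, mul_zero]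
      · have : x.1 = 0 := by
          ext s
          fin_cases s
          · change x.1 0 = 0; omega
          · change x.1 1 = 0; omega
          · change x.1 2 = 0; omega
        rw [this, coeff_zero_eq_constantCoeff_apply, hE, zero_mul]
    cases k with
    | zero => simpa [hr, hμ] using r0
    | succ k => simpa [hr, hμ, ih k (Nat.lt_succ_self k)] using rs k

/-! ### Rigidity, degree by degree -/

theorem Param.natCast_add_mul_ne_zero (p : Param) (k : ℕ) {m : ℕ} (hm : m ≠ 0) :
    (k : ℂ) + m * (p.a₁ + p.a₂) ≠ 0 := by
  intro h
  have hm' : (m : ℂ) ≠ 0 := Nat.cast_ne_zero.2 hm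
  refine p.nondegenerate (-((k : ℚ) / m)) (neg_nonpos.2 (by positivity)) ?_
  push_cast
  field_simp
  linear_combination h

theorem sub_C_mul_X_one_mem_succ {p : Param} {n : ℕ} {φ u : Series} {β θ : ℂ} {e : PowerSeries ℂ}
    (hn : 2 ≤ n) (hβ : β ≠ 0) (he : PowerSeries.constantCoeff e = 0)
    (hφ : φ - C β * X 1 ∈ yIdeal n) (hu : u - C θ * (X 1 * X 2) ∈ yIdeal (n + 1))
    (h : lieDeriv (normalForm p) φ = (C (-p.lam) + C p.a₁ * X 0 + e.subst u) * φ) :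
    φ - C β * X 1 ∈ yIdeal (n + 1) ∧
      ∀ m, m + 1 + m = n → PowerSeries.coeff m p.c₁ = θ ^ m * PowerSeries.coeff m e := by
  have hm := affinePart_mem (c := p.c₁) he
    (by rw [euler_X_self, euler_X_of_ne (by decide), mul_zero, add_zero]) hφ hu h
  refine ⟨mem_yIdeal_succ.2 ⟨hφ, fun k i j hij => ?_⟩, fun m hm' => ?_⟩
  · obtain ⟨r0, rs⟩ := recurrence_of_mem hm hij
    have hX : coeff (expo k i j) (X 1 : Series) = 0 := by
      rw [X_one_eq, coeff_monomial_ne]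
      rw [Ne, expo_inj]
      omega
    rw [map_sub, coeff_C_mul, hX, mul_zero, sub_zero]
    simp only [coeff_C_mul, map_sub, coeff_subst_resonant_mul_X_one, Nat.succ_ne_zero, false_and,
      if_false, sub_zero, mul_zero, add_zero] at r0 rs
    -- The resonant exponents are (j + 1, j), with j ≥ 1 because n ≥ 2. The series terms contribute
    -- only at x^0, so they are absent from `rs`.
    by_cases hr : i = j + 1
    · subst hr
      have := rs k
      push_cast at this
      refine (mul_eq_zero.1 (?_ : ((k : ℂ) + j * (p.a₁ + p.a₂)) * _ = 0)).resolve_left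
        (p.natCast_add_mul_ne_zero k (by omega))
      linear_combination this
    · refine eq_zero_of_recurrence (g := fun k => coeff (expo k i j) φ)
        (A := p.lam * (j - i) - -p.lam) ?_ ?_ rs k
      · intro h0
        have h1 : (j : ℂ) + 1 - i = 0 :=
          (mul_eq_zero.1 (by linear_combination h0)).resolve_left p.lam_ne_zero
        exact hr (by exact_mod_cast (sub_eq_zero.1 h1).symm)
      · simpa [hr] using r0
  -- At the resonant exponent the equation for x^0 loses its φ-term and leaves only β times the
  -- difference of the series coefficients.
  · have r0 := (recurrence_of_mem hm hm').1
    simp only [coeff_C_mul, map_sub, coeff_subst_resonant_mul_X_one, and_self, if_true] at r0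
    push_cast at r0
    refine mul_left_cancel₀ hβ ?_
    linear_combination r0

theorem sub_C_mul_X_two_mem_succ {p : Param} {n : ℕ} {φ u : Series} {β θ : ℂ} {e : PowerSeries ℂ}
    (hn : 2 ≤ n) (hβ : β ≠ 0) (he : PowerSeries.constantCoeff e = 0)
    (hφ : φ - C β * X 2 ∈ yIdeal n) (hu : u - C θ * (X 1 * X 2) ∈ yIdeal (n + 1))
    (h : lieDeriv (normalForm p) φ = (C p.lam + C p.a₂ * X 0 + e.subst u) * φ) :
    φ - C β * X 2 ∈ yIdeal (n + 1) ∧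
      ∀ m, m + (m + 1) = n → PowerSeries.coeff m p.c₂ = θ ^ m * PowerSeries.coeff m e := by
  have hm := affinePart_mem (c := p.c₂) he
    (by rw [euler_X_self, euler_X_of_ne (by decide), mul_zero, zero_add]) hφ hu h
  refine ⟨mem_yIdeal_succ.2 ⟨hφ, fun k i j hij => ?_⟩, fun m hm' => ?_⟩
  · obtain ⟨r0, rs⟩ := recurrence_of_mem hm hij
    have hX : coeff (expo k i j) (X 2 : Series) = 0 := by
      rw [X_two_eq, coeff_monomial_ne]
      rw [Ne, expo_inj]
      omega
    rw [map_sub, coeff_C_mul, hX, mul_zero, sub_zero]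
    simp only [coeff_C_mul, map_sub, coeff_subst_resonant_mul_X_two, Nat.succ_ne_zero, false_and,
      if_false, sub_zero, mul_zero, add_zero] at r0 rs
    by_cases hr : j = i + 1
    · subst hr
      have := rs k
      push_cast at this
      refine (mul_eq_zero.1 (?_ : ((k : ℂ) + i * (p.a₁ + p.a₂)) * _ = 0)).resolve_left
        (p.natCast_add_mul_ne_zero k (by omega))
      linear_combination this
    · refine eq_zero_of_recurrence (g := fun k => coeff (expo k i j) φ)
        (A := p.lam * (j - i) - p.lam) ?_ ?_ rs k
      · intro h0
        have h1 : (j : ℂ) - (i + 1) = 0 :=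
          (mul_eq_zero.1 (by linear_combination h0)).resolve_left p.lam_ne_zero
        exact hr (by exact_mod_cast sub_eq_zero.1 h1)
      · simpa [hr] using r0
  · have r0 := (recurrence_of_mem hm hm').1
    simp only [coeff_C_mul, map_sub, coeff_subst_resonant_mul_X_two, and_self, if_true] at r0
    push_cast at r0
    refine mul_left_cancel₀ hβ ?_
    linear_combination r0

theorem linear_recurrence {p : Param} {φ u : Series} {μ b : ℂ} {e : PowerSeries ℂ}
    (he : PowerSeries.constantCoeff e = 0) (hφ : φ ∈ yIdeal 1) (hu : u ∈ yIdeal 2)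
    (h : lieDeriv (normalForm p) φ = (C μ + C b * X 0 + e.subst u) * φ) {i j : ℕ}
    (hij : i + j = 1) :
    (p.lam * (j - i) - μ) * coeff (expo 0 i j) φ = 0 ∧
    ∀ k : ℕ, (p.lam * (j - i) - μ) * coeff (expo (k + 1) i j) φ +
      (k + (p.a₁ * i + p.a₂ * j - b)) * coeff (expo k i j) φ = 0 := by
  -- In degree one the approximation y = 0 suffices: φ is in `yIdeal 1` and u in `yIdeal 2`.
  have hm := affinePart_mem (n := 1) (y := 0) (β := 0) (θ := 0) (c := 0) he (by simp [euler])
    (by simpa using hφ) (by simpa using hu) h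
  simpa using recurrence_of_mem hm hij

theorem eq_and_coeff_eq_zero_of_recurrence {g : ℕ → ℂ} {B : ℂ} (h0 : g 0 ≠ 0)
    (h : ∀ k : ℕ, (k + B) * g k = 0) : B = 0 ∧ ∀ k, k ≠ 0 → g k = 0 := by
  have hB : B = 0 := by simpa [h0] using h 0
  exact ⟨hB, fun k hk => by simpa [hB, hk] using h k⟩

/-- The product is known one degree further than its factors, since each error is multiplied by a
series vanishing at y = 0. -/
theorem mul_sub_resonant_mem {n : ℕ} {φ₁ φ₂ : Series} {β γ : ℂ} (h₂ : φ₂ ∈ yIdeal 1)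
    (hβ : φ₁ - C β * X 1 ∈ yIdeal n) (hγ : φ₂ - C γ * X 2 ∈ yIdeal n) :
    φ₁ * φ₂ - C (β * γ) * (X 1 * X 2) ∈ yIdeal (n + 1) := by
  have m₂ := Ideal.mul_mem_left _ (C β) (mul_mem_yIdeal hγ X_one_mem)
  convert Ideal.add_mem _ (mul_mem_yIdeal hβ h₂) m₂ using 1
  rw [map_mul]
  ring

/-! ### Conjugate normal forms have parameters in one orbit -/

/-- In degree one the off-diagonal exponents have A = ±2λ ≠ 0, so `hJ` makes both diagonal
coefficients β, γ nonzero; these are resonant and give a₁ and a₂. Higher degrees follow by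
induction. -/
theorem exists_eq_scale_of_isSolution {p p' : Param} {φ₁ φ₂ : Series} (hl : p.lam = p'.lam)
    (h : IsSolution (normalForm p) p' φ₁ φ₂) (h₁ : φ₁ ∈ yIdeal 1) (h₂ : φ₂ ∈ yIdeal 1)
    (hJ : coeff (expo 0 1 0) φ₁ * coeff (expo 0 0 1) φ₂ -
      coeff (expo 0 0 1) φ₁ * coeff (expo 0 1 0) φ₂ ≠ 0) :
    ∃ θ : ℂˣ, p = p'.scale θ := by
  obtain ⟨e₁, e₂⟩ := h
  rw [← hl] at e₁ e₂
  have hu : φ₁ * φ₂ ∈ yIdeal 2 := mul_mem_yIdeal h₁ h₂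
  have hl2 : p.lam + p.lam ≠ 0 := by
    rw [← two_mul]
    exact mul_ne_zero two_ne_zero p.lam_ne_zero
  have off₁ : ∀ k, coeff (expo k 0 1) φ₁ = 0 := by
    obtain ⟨r0, rs⟩ := linear_recurrence p'.c₁_zero h₁ hu e₁ (i := 0) (j := 1) rfl
    exact eq_zero_of_recurrence (by simpa using hl2) r0 rs
  have off₂ : ∀ k, coeff (expo k 1 0) φ₂ = 0 := by
    obtain ⟨r0, rs⟩ := linear_recurrence p'.c₂_zero h₂ hu e₂ (i := 1) (j := 0) rfl
    refine eq_zero_of_recurrence ?_ r0 rs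
    rw [← neg_ne_zero]
    convert hl2 using 1
    push_cast
    ring
  rw [off₁, zero_mul, sub_zero] at hJ
  obtain ⟨hβ, hγ⟩ := mul_ne_zero_iff.1 hJ
  obtain ⟨ha₁, diag₁⟩ := eq_and_coeff_eq_zero_of_recurrence (B := p.a₁ - p'.a₁)
    (g := fun k => coeff (expo k 1 0) φ₁) hβ fun k => by
      have := (linear_recurrence p'.c₁_zero h₁ hu e₁ (i := 1) (j := 0) rfl).2 k
      push_cast at this
      linear_combination this
  obtain ⟨ha₂, diag₂⟩ := eq_and_coeff_eq_zero_of_recurrence (B := p.a₂ - p'.a₂)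
    (g := fun k => coeff (expo k 0 1) φ₂) hγ fun k => by
      have := (linear_recurrence p'.c₂_zero h₂ hu e₂ (i := 0) (j := 1) rfl).2 k
      push_cast at this
      linear_combination this
  generalize hβ' : coeff (expo 0 1 0) φ₁ = β at *
  generalize hγ' : coeff (expo 0 0 1) φ₂ = γ at *
  rw [sub_eq_zero] at ha₁ ha₂
  rw [← ha₁] at e₁
  rw [← ha₂] at e₂
  have base₁ : φ₁ - C β * X 1 ∈ yIdeal (1 + 1) := by
    classical
    refine mem_yIdeal_succ.2 ⟨Ideal.sub_mem _ h₁ (Ideal.mul_mem_left _ _ X_one_mem),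
      fun k i j hij => ?_⟩
    rw [map_sub, coeff_C_mul, X_one_eq, coeff_monomial]
    obtain ⟨rfl, rfl⟩ | ⟨rfl, rfl⟩ : i = 0 ∧ j = 1 ∨ i = 1 ∧ j = 0 := by omega
    · simp [expo_inj, off₁]
    · rcases eq_or_ne k 0 with rfl | hk
      · simp [hβ']
      · simp [expo_inj, hk, diag₁ k hk]
  have base₂ : φ₂ - C γ * X 2 ∈ yIdeal (1 + 1) := by
    classical
    refine mem_yIdeal_succ.2 ⟨Ideal.sub_mem _ h₂ (Ideal.mul_mem_left _ _ X_two_mem),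
      fun k i j hij => ?_⟩
    rw [map_sub, coeff_C_mul, X_two_eq, coeff_monomial]
    obtain ⟨rfl, rfl⟩ | ⟨rfl, rfl⟩ : i = 1 ∧ j = 0 ∨ i = 0 ∧ j = 1 := by omega
    · simp [expo_inj, off₂]
    · rcases eq_or_ne k 0 with rfl | hk
      · simp [hγ']
      · simp [expo_inj, hk, diag₂ k hk]
  have main (n : ℕ) (hn : 2 ≤ n) : φ₁ - C β * X 1 ∈ yIdeal n ∧ φ₂ - C γ * X 2 ∈ yIdeal n := by
    induction n, hn using Nat.le_induction with
    | base => exact ⟨base₁, base₂⟩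
    | succ n hn ih =>
      have hu' := mul_sub_resonant_mem h₂ ih.1 ih.2
      exact ⟨(sub_C_mul_X_one_mem_succ hn hβ p'.c₁_zero ih.1 hu' e₁).1,
        (sub_C_mul_X_two_mem_succ hn hγ p'.c₂_zero ih.2 hu' e₂).1⟩
  refine ⟨Units.mk0 (β * γ) hJ, Param.ext hl ha₁ ha₂ ?_ ?_⟩ <;>
    refine PowerSeries.ext fun m => ?_ <;>
    simp only [Param.scale, Units.val_mk0, PowerSeries.coeff_rescale] <;>
    rcases Nat.eq_zero_or_pos m with rfl | hm
  · simp [p.c₁_zero, p'.c₁_zero]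
  -- The m-th coefficient of c₁ is read off at y₁^(m+1) y₂^m, of degree 2m + 1 ≥ 2.
  · obtain ⟨m₁, m₂⟩ := main (m + 1 + m) (by omega)
    exact (sub_C_mul_X_one_mem_succ (by omega) hβ p'.c₁_zero m₁ (mul_sub_resonant_mem h₂ m₁ m₂)
      e₁).2 m rfl
  · simp [p.c₂_zero, p'.c₂_zero]
  · obtain ⟨m₁, m₂⟩ := main (m + (m + 1)) (by omega)
    exact (sub_C_mul_X_two_mem_succ (by omega) hγ p'.c₂_zero m₂ (mul_sub_resonant_mem h₂ m₁ m₂)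
      e₂).2 m rfl

theorem IsSolution.swap {Y : VectorField} {p : Param} {φ₁ φ₂ : Series}
    (h : IsSolution Y p φ₁ φ₂) : IsSolution Y p.swap φ₂ φ₁ := by
  obtain ⟨h₁, h₂⟩ := h
  refine ⟨?_, ?_⟩
  · simpa only [Param.swap, neg_neg, mul_comm φ₂] using h₂
  · simpa only [Param.swap, mul_comm φ₂] using h₁

theorem constantCoeff_pderiv (i : Fin 3) (f : Series) :
    constantCoeff (pderiv ℂ i f) = coeff (Finsupp.single i 1) f := by
  rw [← coeff_zero_eq_constantCoeff_apply, coeff_pderiv]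
  simp

theorem exists_eq_scale_of_fiberedConjugate {p p' : Param}
    (h : FiberedConjugate (normalForm p) (normalForm p')) :
    ∃ θ : ℂˣ, p = p'.scale θ ∨ p = p'.swap.scale θ := by
  obtain ⟨Φ, hΦ, hc⟩ := h
  have hs := (Φ.conjugates_normalForm_iff hΦ _ rfl p').1 hc
  have hJ : coeff (expo 0 1 0) (Φ.comp 1) * coeff (expo 0 0 1) (Φ.comp 2) -
      coeff (expo 0 0 1) (Φ.comp 1) * coeff (expo 0 1 0) (Φ.comp 2) ≠ 0 := by
    have := Φ.isUnit_jacobian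
    rw [Matrix.isUnit_iff_isUnit_det, Matrix.det_fin_three, isUnit_iff_ne_zero] at this
    simp only [jacobianAtZero, Matrix.of_apply] at this
    rw [hΦ, pderiv_X_self, pderiv_X_of_ne (by decide), pderiv_X_of_ne (by decide)] at this
    simp only [map_one, map_zero, one_mul, zero_mul, sub_zero, add_zero,
      constantCoeff_pderiv] at this
    rw [eq_expo (Finsupp.single 1 1), eq_expo (Finsupp.single 2 1)] at this
    simpa using this
  have hu : constantCoeff (Φ.comp 1 * Φ.comp 2) = 0 := by simp [Φ.comp_zero]
  have h₁ := mem_yIdeal_one (neg_ne_zero.2 p'.lam_ne_zero) p'.c₁_zero hu hs.1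
  have h₂ := mem_yIdeal_one p'.lam_ne_zero p'.c₂_zero hu hs.2
  by_cases hl : p.lam = p'.lam
  · exact (exists_eq_scale_of_isSolution hl hs h₁ h₂ hJ).imp fun _ => Or.inl
  · refine (exists_eq_scale_of_isSolution (p' := p'.swap) ?_ hs.swap h₂ h₁ ?_).imp
      fun _ => Or.inr
    -- The y₁-coefficient of φ₁ is killed by λ' - λ ≠ 0; invertibility then makes its y₂-coefficient
    -- nonzero, which forces λ + λ' = 0. Exchanging φ₁ and φ₂ reduces to equal λ.
    · have hβ : coeff (expo 0 1 0) (Φ.comp 1) = 0 := by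
        have := (linear_recurrence p'.c₁_zero h₁ (mul_mem_yIdeal h₁ h₂) hs.1
          (i := 1) (j := 0) rfl).1
        refine (mul_eq_zero.1 this).resolve_left fun h0 => hl ?_
        push_cast at h0
        linear_combination -h0
      rw [hβ, zero_mul, zero_sub, neg_ne_zero] at hJ
      have := (linear_recurrence p'.c₁_zero h₁ (mul_mem_yIdeal h₁ h₂) hs.1
        (i := 0) (j := 1) rfl).1
      have h0 := (mul_eq_zero.1 this).resolve_right (left_ne_zero_of_mul hJ)
      change p.lam = -p'.lam
      push_cast at h0
      linear_combination h0
    · contrapose! hJ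
      linear_combination -hJ

end SaddleNode
end

theorem theorem2 (p p' : SaddleNode.Param) :
    SaddleNode.FiberedConjugate (SaddleNode.normalForm p) (SaddleNode.normalForm p') ↔
      p ∈ MulAction.orbit (ℂˣ × Multiplicative (ZMod 2)) p' := by
  rw [SaddleNode.mem_orbit_iff]
  refine ⟨SaddleNode.exists_eq_scale_of_fiberedConjugate, ?_⟩
  rintro ⟨θ, rfl | rfl⟩
  · exact SaddleNode.fiberedConjugate_scale θ p'
  · exact SaddleNode.fiberedConjugate_scale_swap θ p'
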